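/- Let $(X,\mathcal B,\mu)$ be a probability space and let $p>1$. Let $(a_n)_{n\ge 1}$ be real numbers with $a_n>2$ and of super-polynomial growth, i.e. $a_n/n^k\to\infty$ for every integer $k\ge 0$. Let $A_n\in\mathcal B$ $(n\ge 1)$ be pairwise disjoint sets of positive measure with $\sum_{n\ge1}a_n\mu(A_n)\le \tfrac12$, and let $B\in\mathcal B$ be disjoint from $\bigcup_n A_n$ with $\mu(B)=\sum_{n\ge1}a_n\mu(A_n)$. Let $f:X\to\mathbb R$ be the function with $f=a_n$ on $A_n$ for each $n$, $f=-1$ on $B$, and $f=0$ elsewhere (so $f$ is integrable with $\int_X f\,d\mu=0$), and suppose that $f$ belongs to $\mathcal F_p$, i.e. that $\lim_{n\to\infty}a_n^p\,\mu(A_n)=\infty$. Then for every invertible (with measurable inverse) ergodic $\mu$-preserving transformation $T:X\to X$ there are integers $v_n$ and positive integers $L_n$ $(n\ge1)$ such that $(L_n)$ is non-decreasing, and strictly increasing if $p\le 2$, $L_n\ge n^{1/(p-1)}$ for all $n\ge 1$, and for a.e. $x\in X$ $$\limsup_{n\to\infty}\frac1{L_n}\sum_{i=v_n+1}^{v_n+L_n}f(T^ix)>0$$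 (the limsup is taken in $[-\infty,\infty]$). Moreover, for a.e. $x\in X$ these averages do not converge to a real number as $n\to\infty$. -/

import Mathlib

open MeasureTheory Filter Topology

/-- Super-polynomial growth: the sequence eventually dominates every power of `n`. -/
def SuperPolynomialGrowth (a : ℕ → ℝ) : Prop :=
  ∀ k : ℕ, Tendsto (fun n : ℕ => a n / (n : ℝ) ^ k) atTop atTop

/-- `f` is the function determined by the heights `a n`, the sets `A n` and the set `B`:
it equals `a n` on `A n`, `-1` on `B` and `0` elsewhere, where the data are admissible.
All sequences are indexed from `0`; shifting the index changes none of the conditions. -/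
structure IsBadFunctionWith {X : Type*} [MeasurableSpace X] (μ : Measure X)
    (a : ℕ → ℝ) (A : ℕ → Set X) (B : Set X) (f : X → ℝ) : Prop where
  two_lt : ∀ n, 2 < a n
  growth : SuperPolynomialGrowth a
  measurableSet_A : ∀ n, MeasurableSet (A n)
  disjoint_A : Pairwise fun m n => Disjoint (A m) (A n)
  measure_A_pos : ∀ n, 0 < μ (A n)
  sum_le : ∑' n, ENNReal.ofReal (a n) * μ (A n) ≤ 1 / 2
  measurableSet_B : MeasurableSet B
  disjoint_B : Disjoint B (⋃ n, A n)
  measure_B : μ B = ∑' n, ENNReal.ofReal (a n) * μ (A n)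
  apply_A : ∀ n, ∀ x ∈ A n, f x = a n
  apply_B : ∀ x ∈ B, f x = -1
  apply_else : ∀ x, x ∉ B → (∀ n, x ∉ A n) → f x = 0

/-- The family `𝓕_p`: functions as above for which `a n ^ p * μ (A n) → ∞`. -/
def badFamily {X : Type*} [MeasurableSpace X] (μ : Measure X) (p : ℝ) : Set (X → ℝ) :=
  {f | ∃ (a : ℕ → ℝ) (A : ℕ → Set X) (B : Set X), IsBadFunctionWith μ a A B f ∧
    Tendsto (fun n => a n ^ p * μ.real (A n)) atTop atTop}

/-- The moving average `(1 / L) * ∑_{i = v + 1}^{v + L} f (T ^ i x)` of an invertible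
measurable map; `T ^ i` is the integer power in the group of permutations of `X`. -/
noncomputable def movingAverage {X : Type*} [MeasurableSpace X] (T : X ≃ᵐ X) (f : X → ℝ)
    (v : ℤ) (L : ℕ) (x : X) : ℝ :=
  (1 / (L : ℝ)) * ∑ i ∈ Finset.Icc (v + 1) (v + (L : ℤ)),
    f (((T.toEquiv : Equiv.Perm X) ^ i) x)

/-! ### Mean ergodic theorem in L² and L¹ -/

section MeanErgodic

variable {X : Type*} [MeasurableSpace X] {μ : Measure X} {T : X → X}

/-! Fix a height `a = a m` with its set `A = A m`, and let F_l be the set of points whose first l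
iterates visit A at least 4l/a times. Since f ≥ a·1_A - 1, every average of length L ∈ [l, 2l]
started in F_l is at least 1.

The heart is that l^(p-1) μ(F_l) is unbounded over m and l (`exists_lt_rpow_mul_measureReal`).
Doubling l from about a/4 upwards bounds μ(A) by 8/a times the sum of the μ(F_{2^j l}), up to a
vanishing error. If l^(p-1) μ(F_l) ≤ R throughout, this sum is geometric and a^p μ(A) is bounded by
a constant multiple of R, against a_n^p μ(A_n) → ∞.

By ergodicity, a number of order 1/μ(F_l) of preimages of F_l under iterates of T covers all but ε
of the space. This number is much smaller than l^(p-1) along suitable m, l, so that many consecutive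
indices can be given lengths in [l, 2l] without violating L_n ≥ n^(1/(p-1)). Concatenating such
blocks with ε = 2^(-k), Borel–Cantelli makes almost every point see an average at least 1 infinitely
often.

The averages also tend to ∫ f = 0 in L¹, because L_n → ∞ and shifts preserve the norm. A subsequence
therefore tends to 0 a.e., which excludes any real limit. -/

theorem MeasureTheory.MeasurePreserving.memLp_birkhoffAverage {q : ENNReal} {g : X → ℝ}
    (hT : MeasurePreserving T μ μ) (hg : MemLp g q μ) (n : ℕ) :
    MemLp (birkhoffAverage ℝ T g n) q μ := by
  have h : MemLp (fun x => ∑ k ∈ Finset.range n, g (T^[k] x)) q μ :=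
    memLp_finsetSum _ fun k _ => hg.comp_measurePreserving (hT.iterate k)
  exact h.const_smul ((n : ℝ)⁻¹)

theorem MeasureTheory.MeasurePreserving.integrable_birkhoffAverage {g : X → ℝ}
    (hT : MeasurePreserving T μ μ) (hg : Integrable g μ) (n : ℕ) :
    Integrable (birkhoffAverage ℝ T g n) μ :=
  memLp_one_iff_integrable.1 (hT.memLp_birkhoffAverage (memLp_one_iff_integrable.2 hg) n)

theorem MeasureTheory.MeasurePreserving.integral_comp_iterate {g : X → ℝ}
    (hT : MeasurePreserving T μ μ) (hg : AEStronglyMeasurable g μ) (k : ℕ) :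
    ∫ x, g (T^[k] x) ∂μ = ∫ x, g x ∂μ := by
  have h := hT.iterate k
  conv_rhs => rw [← h.map_eq]
  rw [integral_map h.aemeasurable (by rwa [h.map_eq])]

theorem MeasureTheory.MeasurePreserving.integral_birkhoffAverage {g : X → ℝ}
    (hT : MeasurePreserving T μ μ) (hg : Integrable g μ) {n : ℕ} (hn : n ≠ 0) :
    ∫ x, birkhoffAverage ℝ T g n x ∂μ = ∫ x, g x ∂μ := by
  simp only [birkhoffAverage, birkhoffSum, smul_eq_mul]
  rw [integral_const_mul, integral_finsetSum]
  · simp_rw [hT.integral_comp_iterate hg.aestronglyMeasurable]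
    simp [hn]
  · exact fun k _ => (hT.iterate k).integrable_comp_of_integrable hg

theorem MeasureTheory.MeasurePreserving.eLpNorm_birkhoffAverage_le {g : X → ℝ}
    (hT : MeasurePreserving T μ μ) (hg : AEStronglyMeasurable g μ) (n : ℕ) :
    eLpNorm (birkhoffAverage ℝ T g n) 1 μ ≤ eLpNorm g 1 μ := by
  rcases Nat.eq_zero_or_pos n with rfl | hn
  · simp
  have h1 : birkhoffAverage ℝ T g n
      = (n : ℝ)⁻¹ • ∑ k ∈ Finset.range n, (g ∘ T^[k]) := by
    ext x; simp [birkhoffAverage, birkhoffSum]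
  rw [h1, eLpNorm_const_smul]
  have h2 : eLpNorm (∑ k ∈ Finset.range n, (g ∘ T^[k])) 1 μ ≤ n * eLpNorm g 1 μ := by
    refine (eLpNorm_sum_le (fun k _ => hg.comp_measurePreserving (hT.iterate k)) le_rfl).trans ?_
    simp [eLpNorm_comp_measurePreserving hg (hT.iterate _)]
  refine (mul_le_mul_right h2 _).trans ?_
  rw [← mul_assoc]
  have : ‖(n : ℝ)⁻¹‖ₑ * (n : ENNReal) = 1 := by
    rw [enorm_inv (by positivity)]
    simp only [Real.enorm_natCast]
    exact ENNReal.inv_mul_cancel (by positivity) (by simp)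
  simp [this]

/-- Von Neumann's theorem for the Koopman operator: averages converge to the projection onto its
fixed vectors. These are constants by ergodicity, and integrating identifies the constant. -/
theorem Ergodic.tendsto_birkhoffAverage_L2 [IsProbabilityMeasure μ] (hT : Ergodic T μ)
    {g : X → ℝ} (hg : MemLp g 2 μ) :
    Tendsto (fun n => eLpNorm (birkhoffAverage ℝ T g n - fun _ => ∫ x, g x ∂μ) 2 μ)
      atTop (𝓝 0) := by
  have hT' := hT.toMeasurePreserving
  let U : Lp ℝ 2 μ →ₗᵢ[ℝ] Lp ℝ 2 μ := Lp.compMeasurePreservingₗᵢ ℝ T hT'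
  have hU : ∀ h (hh : MemLp h 2 μ), ∀ k, U^[k] (hh.toLp h) =
      (hh.comp_measurePreserving (hT'.iterate k)).toLp (h ∘ T^[k]) := by
    intro h hh k
    induction k with
    | zero => rfl
    | succ k ih =>
      rw [Function.iterate_succ_apply', ih]
      change Lp.compMeasurePreserving T hT' _ = _
      rw [Lp.toLp_compMeasurePreserving]
      rfl
  have hav : ∀ n, birkhoffAverage ℝ U _root_.id n (hg.toLp g) =
      (hT'.memLp_birkhoffAverage hg n).toLp _ := by
    intro n
    apply Lp.ext
    refine EventuallyEq.trans ?_ (MemLp.coeFn_toLp _).symm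
    simp only [birkhoffAverage, birkhoffSum, id]
    have h1 := Lp.coeFn_smul (n : ℝ)⁻¹ (∑ k ∈ Finset.range n, U^[k] (hg.toLp g))
    have h2 := Lp.coeFn_finsetSum (Finset.range n) (fun k => U^[k] (hg.toLp g))
    have h3 : ∀ k, U^[k] (hg.toLp g) =ᵐ[μ] g ∘ T^[k] := by
      intro k; rw [hU]; exact MemLp.coeFn_toLp _
    filter_upwards [h1, h2, ae_all_iff.2 h3] with x h1 h2 h3
    rw [h1, Pi.smul_apply, h2]
    simp [h3, birkhoffAverage, birkhoffSum]
  have hlim := U.toContinuousLinearMap.tendsto_birkhoffAverage_orthogonalProjection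
    U.norm_toContinuousLinearMap_le (hg.toLp g)
  set P : Lp ℝ 2 μ := ((U.toContinuousLinearMap.eqLocus
    (1 : Lp ℝ 2 μ →L[ℝ] Lp ℝ 2 μ)).orthogonalProjectionOnto (hg.toLp g) : Lp ℝ 2 μ) with hP
  have hfix : U P = P := ((U.toContinuousLinearMap.eqLocus
    (1 : Lp ℝ 2 μ →L[ℝ] Lp ℝ 2 μ)).orthogonalProjectionOnto (hg.toLp g)).2
  obtain ⟨c, hc⟩ := hT.eq_const_of_compMeasurePreserving_eq (g := (P : X →ₘ[μ] ℝ))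
    (congrArg Subtype.val hfix)
  have hc' : P =ᵐ[μ] fun _ => c := by
    rw [hc]; exact AEEqFun.coeFn_const _ _
  have hlim2 : Tendsto (fun n => eLpNorm (birkhoffAverage ℝ T g n - fun _ => c) 2 μ)
      atTop (𝓝 0) := by
    have := (Lp.tendsto_Lp_iff_tendsto_eLpNorm' _ _).1 hlim
    refine this.congr fun n => eLpNorm_congr_ae ?_
    have h4 : ((birkhoffAverage ℝ U _root_.id n (hg.toLp g) : Lp ℝ 2 μ) : X → ℝ) =ᵐ[μ] birkhoffAverage ℝ T g n := by
      rw [hav]; exact MemLp.coeFn_toLp _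
    exact h4.sub hc'
  have hint : Integrable g μ := hg.integrable (by norm_num)
  have hcI : c = ∫ x, g x ∂μ := by
    have h1 : Tendsto (fun n => eLpNorm (birkhoffAverage ℝ T g n - fun _ => c) 1 μ)
        atTop (𝓝 0) := by
      refine tendsto_of_tendsto_of_tendsto_of_le_of_le tendsto_const_nhds hlim2
        (fun _ => zero_le) fun n => ?_
      exact eLpNorm_le_eLpNorm_of_exponent_le (by norm_num)
        ((hT'.integrable_birkhoffAverage hint n).sub (integrable_const c)).aestronglyMeasurable
    have h2 := tendsto_integral_of_L1' (fun _ => c) aestronglyMeasurable_const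
      (.of_forall fun n => hT'.integrable_birkhoffAverage hint n) h1
    have h3 : Tendsto (fun n => ∫ x, birkhoffAverage ℝ T g n x ∂μ) atTop (𝓝 (∫ x, g x ∂μ)) := by
      refine tendsto_const_nhds.congr' ?_
      filter_upwards [eventually_ne_atTop 0] with n hn
      rw [hT'.integral_birkhoffAverage hint hn]
    simpa using tendsto_nhds_unique h2 h3
  rwa [← hcI]

/-- Simple functions lie in L² and are dense in L¹, and averaging contracts the L¹ norm; an ε/3
argument transfers the L² result. -/
theorem Ergodic.tendsto_birkhoffAverage_L1 [IsProbabilityMeasure μ] (hT : Ergodic T μ)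
    {f : X → ℝ} (hf : Integrable f μ) :
    Tendsto (fun n => eLpNorm (birkhoffAverage ℝ T f n - fun _ => ∫ x, f x ∂μ) 1 μ)
      atTop (𝓝 0) := by
  have hT' := hT.toMeasurePreserving
  rw [ENNReal.tendsto_nhds_zero]
  intro ε hε
  have hε3 : ε / 3 ≠ 0 := by simp [hε.ne']
  obtain ⟨g, hg, -⟩ := (memLp_one_iff_integrable.2 hf).exists_simpleFunc_eLpNorm_sub_lt
    (by simp) hε3
  have hgm : MemLp g 2 μ := g.memLp_of_isFiniteMeasure 2 μ
  have hgi : Integrable g μ := hgm.integrable (by norm_num)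
  have hlim := ENNReal.tendsto_nhds_zero.1 (hT.tendsto_birkhoffAverage_L2 hgm) (ε / 3)
    (pos_iff_ne_zero.2 hε3)
  filter_upwards [hlim] with n hn
  have hfg : AEStronglyMeasurable (f - ⇑g) μ := (hf.sub hgi).aestronglyMeasurable
  have e : birkhoffAverage ℝ T f n - (fun _ => ∫ x, f x ∂μ)
      = birkhoffAverage ℝ T (f - ⇑g) n
        + ((birkhoffAverage ℝ T g n - fun _ => ∫ x, g x ∂μ)
        + fun _ => (∫ x, g x ∂μ) - ∫ x, f x ∂μ) := by
    rw [birkhoffAverage_sub]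
    ext x
    simp only [Pi.sub_apply, Pi.add_apply]
    ring
  have m1 := (hT'.integrable_birkhoffAverage (hf.sub hgi) n).aestronglyMeasurable
  have m2 := ((hT'.integrable_birkhoffAverage hgi n).sub
    (integrable_const (∫ x, g x ∂μ))).aestronglyMeasurable
  have b1 := (hT'.eLpNorm_birkhoffAverage_le hfg n).trans hg.le
  have b2 := (eLpNorm_le_eLpNorm_of_exponent_le (p := 1) (q := 2) (by norm_num) m2).trans hn
  have b3 : eLpNorm (fun _ : X => (∫ x, g x ∂μ) - ∫ x, f x ∂μ) 1 μ ≤ ε / 3 := by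
    rw [eLpNorm_const' _ (by simp) (by simp)]
    simp only [measure_univ, ENNReal.one_rpow, mul_one]
    rw [← integral_sub hgi hf]
    refine (enorm_integral_le_lintegral_enorm _).trans ?_
    rw [eLpNorm_sub_comm, eLpNorm_one_eq_lintegral_enorm] at hg
    exact hg.le
  rw [e]
  refine (eLpNorm_add_le m1 (m2.add aestronglyMeasurable_const) le_rfl).trans ?_
  refine (add_le_add b1 ((eLpNorm_add_le m2 aestronglyMeasurable_const le_rfl).trans
    (add_le_add b2 b3))).trans ?_
  rw [← add_assoc, ENNReal.add_thirds]

end MeanErgodic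

/-! ### Covering by preimages of a set of positive measure -/

section Covering

variable {X : Type*} [MeasurableSpace X] {μ : Measure X} {T : X → X}

/-- The Cesàro means of μ(D ∩ T^(-k)F) tend to μ(D)μ(F), so these numbers cannot all stay below half
of that limit. -/
theorem Ergodic.exists_measureReal_inter_preimage_compl_le [IsProbabilityMeasure μ]
    (hT : Ergodic T μ) {F : Set X} (hF : MeasurableSet F) (D : Set X) :
    ∃ k : ℕ, μ.real (D ∩ T^[k] ⁻¹' Fᶜ) ≤ (1 - μ.real F / 2) * μ.real D := by
  have hT' := hT.toMeasurePreserving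
  by_contra! hcon
  have hpos : 0 < μ.real F * μ.real D := by
    -- The negated inequality is strict; at k = 0 it already rules out that `F` or `D` is null.
    have h0 := (hcon 0).trans_le (measureReal_mono (μ := μ) (Set.inter_subset_left (s := D)))
    nlinarith [measureReal_nonneg (μ := μ) (s := D), measureReal_nonneg (μ := μ) (s := F)]
  have hint : Integrable (F.indicator (1 : X → ℝ)) μ :=
    (integrable_const (1 : ℝ)).indicator hF
  have hIF : ∫ x, F.indicator (1 : X → ℝ) x ∂μ = μ.real F := integral_indicator_one hF
  have hlim := tendsto_setIntegral_of_L1' _ aestronglyMeasurable_const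
    (.of_forall fun n => hT'.integrable_birkhoffAverage hint n)
    (hT.tendsto_birkhoffAverage_L1 hint) D
  rw [hIF] at hlim
  simp only [integral_const, smul_eq_mul, measureReal_restrict_apply_univ] at hlim
  have hlt : μ.real F * μ.real D / 2 < μ.real D * μ.real F := by linarith
  obtain ⟨n, hn, hn0⟩ := ((hlim.eventually (lt_mem_nhds hlt)).and
    (eventually_ne_atTop 0)).exists
  have hterm : ∀ k, ∫ x in D, F.indicator (1 : X → ℝ) (T^[k] x) ∂μ
      ≤ μ.real F * μ.real D / 2 := by
    intro k
    have hm : MeasurableSet (T^[k] ⁻¹' F) := (hT'.iterate k).measurable hF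
    have e : (fun x => F.indicator (1 : X → ℝ) (T^[k] x)) = (T^[k] ⁻¹' F).indicator 1 := rfl
    rw [e, integral_indicator_one hm, measureReal_restrict_apply hm, Set.inter_comm]
    have h1 := measureReal_inter_add_sdiff (μ := μ) (s := D) hm
    have h2 := hcon k
    rw [Set.preimage_compl, ← Set.sdiff_eq] at h2
    linarith
  have hsum : ∫ x in D, birkhoffAverage ℝ T (F.indicator (1 : X → ℝ)) n x ∂μ
      ≤ μ.real F * μ.real D / 2 := by
    simp only [birkhoffAverage, birkhoffSum, smul_eq_mul]
    rw [integral_const_mul, integral_finsetSum]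
    · have hn' : (0 : ℝ) < n := by positivity
      rw [inv_mul_le_iff₀ hn']
      refine (Finset.sum_le_sum fun k _ => hterm k).trans ?_
      simp
    · exact fun k _ => ((hT'.iterate k).integrable_comp_of_integrable hint).integrableOn
  linarith

/-- Greedy choice: each new time removes at least the fraction μ(F)/2 of what is still uncovered. -/
theorem Ergodic.exists_measureReal_forall_iterate_notMem_le [IsProbabilityMeasure μ]
    (hT : Ergodic T μ) {F : Set X} (hF : MeasurableSet F) (N : ℕ) :
    ∃ w : ℕ → ℕ, μ.real {x | ∀ j < N, T^[w j] x ∉ F} ≤ (1 - μ.real F / 2) ^ N := by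
  have h0 : 0 ≤ 1 - μ.real F / 2 := by linarith [measureReal_le_one (μ := μ) (s := F)]
  induction N with
  | zero => exact ⟨0, by simp⟩
  | succ N ih =>
    obtain ⟨w, hw⟩ := ih
    obtain ⟨k, hk⟩ := hT.exists_measureReal_inter_preimage_compl_le hF
      {x | ∀ j < N, T^[w j] x ∉ F}
    refine ⟨Function.update w N k, ?_⟩
    have hset : {x | ∀ j < N + 1, T^[Function.update w N k j] x ∉ F}
        = {x | ∀ j < N, T^[w j] x ∉ F} ∩ T^[k] ⁻¹' Fᶜ := by
      ext x
      simp only [Set.mem_ofPred_eq, Nat.lt_succ_iff_lt_or_eq, Set.mem_inter_iff, Set.mem_preimage,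
        Set.mem_compl_iff, or_imp, forall_and, forall_eq, Function.update_self]
      refine and_congr_left fun _ => forall₂_congr fun j hj => ?_
      rw [Function.update_of_ne hj.ne]
    rw [hset, pow_succ']
    exact hk.trans (mul_le_mul_of_nonneg_left hw h0)

end Covering

/-! ### Dyadic estimate for frequent visits -/

section FrequentVisits

variable {X : Type*} [MeasurableSpace X] {μ : Measure X} {T : X → X} {A : Set X} {a : ℝ}

/-- The number of visits to `A` of the orbit segment `x, T x, …, T ^ (l - 1) x`. -/
noncomputable def visitCount (T : X → X) (A : Set X) (l : ℕ) (x : X) : ℝ :=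
  birkhoffSum T (A.indicator (1 : X → ℝ)) l x

/-- The points whose first `l` iterates visit `A` at least `4 * l / a` times. -/
def frequentVisits (T : X → X) (A : Set X) (a : ℝ) (l : ℕ) : Set X :=
  {x | 4 * (l : ℝ) ≤ a * visitCount T A l x}

theorem measurable_visitCount (hT : Measurable T) (hA : MeasurableSet A) (l : ℕ) :
    Measurable (visitCount T A l) := by
  unfold visitCount birkhoffSum
  exact Finset.measurable_sum _ fun k _ =>
    (measurable_one.indicator hA).comp (hT.iterate k)

theorem visitCount_nonneg {X : Type*} {T : X → X} {A : Set X} (l : ℕ) (x : X) : 0 ≤ visitCount T A l x := by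
  unfold visitCount birkhoffSum
  exact Finset.sum_nonneg fun _ _ => Set.indicator_nonneg (fun _ _ => zero_le_one) _

theorem visitCount_le {X : Type*} {T : X → X} {A : Set X} (l : ℕ) (x : X) : visitCount T A l x ≤ l := by
  unfold visitCount birkhoffSum
  refine (Finset.sum_le_card_nsmul _ _ 1 fun k _ => ?_).trans (by simp)
  exact Set.indicator_le_self' (fun _ _ => zero_le_one) _

theorem measurableSet_frequentVisits (hT : Measurable T) (hA : MeasurableSet A) (a : ℝ) (l : ℕ) :
    MeasurableSet (frequentVisits T A a l) :=
  measurableSet_le measurable_const ((measurable_visitCount hT hA l).const_mul a)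

theorem integrable_visitCount [IsProbabilityMeasure μ] (hT : Measurable T)
    (hA : MeasurableSet A) (l : ℕ) : Integrable (visitCount T A l) μ :=
  .of_bound (measurable_visitCount hT hA l).aestronglyMeasurable l
    (.of_forall fun x => by
      rw [Real.norm_of_nonneg (visitCount_nonneg l x)]; exact visitCount_le l x)

theorem integral_visitCount [IsProbabilityMeasure μ] (hT : MeasurePreserving T μ μ)
    (hA : MeasurableSet A) (l : ℕ) : ∫ x, visitCount T A l x ∂μ = l * μ.real A := by
  have hint : Integrable (A.indicator (1 : X → ℝ)) μ := (integrable_const (1 : ℝ)).indicator hA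
  simp only [visitCount, birkhoffSum]
  rw [integral_finsetSum]
  rotate_left
  · exact fun k _ => (hT.iterate k).integrable_comp_of_integrable hint
  simp_rw [hT.integral_comp_iterate hint.aestronglyMeasurable]
  simp [integral_indicator_one hA]

/-- Let G be the set where the count S over time l is at least 8l/a. Off G the count is below 8l/a,
which gives the error term. Both G and T^(-l)G lie in F_{2l}, since one half of the segment already
has enough visits for the whole; as S_{2l} = S + S ∘ T^l, the integral over F_{2l} carries the mass
of S on G twice. -/
theorem two_mul_setIntegral_visitCount_le [IsProbabilityMeasure μ] (hT : MeasurePreserving T μ μ)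
    (hA : MeasurableSet A) (ha : 0 < a) (l : ℕ) :
    2 * ∫ x in frequentVisits T A a l, visitCount T A l x ∂μ ≤
      (∫ x in frequentVisits T A a (2 * l), visitCount T A (2 * l) x ∂μ)
        + 16 * l / a * μ.real (frequentVisits T A a l) := by
  set S := visitCount T A l with hS
  set F := frequentVisits T A a l with hF
  set F2 := frequentVisits T A a (2 * l) with hF2
  let G : Set X := {x | 8 * (l : ℝ) ≤ a * S x}
  have mS : Measurable S := measurable_visitCount hT.measurable hA l
  have mF : MeasurableSet F := measurableSet_frequentVisits hT.measurable hA a l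
  have mF2 : MeasurableSet F2 := measurableSet_frequentVisits hT.measurable hA a _
  have mG : MeasurableSet G := measurableSet_le measurable_const (mS.const_mul a)
  have iS : Integrable S μ := integrable_visitCount hT.measurable hA l
  have iS2 : Integrable (visitCount T A (2 * l)) μ := integrable_visitCount hT.measurable hA _
  have iG := iS.indicator mG
  have hS0 : ∀ x, 0 ≤ S x := visitCount_nonneg l
  have hadd : ∀ x, visitCount T A (2 * l) x = S x + S (T^[l] x) := fun x => by
    rw [two_mul]; exact birkhoffSum_add T _ l l x
  have i1 : Integrable (fun x => 8 * (l : ℝ) / a * F.indicator (1 : X → ℝ) x) μ :=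
    (((integrable_const (1 : ℝ)).indicator mF).const_mul _)
  have h1 : ∫ x in F, S x ∂μ ≤ (∫ x, G.indicator S x ∂μ) + 8 * l / a * μ.real F := by
    rw [← integral_indicator mF, ← integral_indicator_one mF, ← integral_const_mul,
      ← integral_add iG i1]
    refine integral_mono (iS.indicator mF)
      (iG.add i1) fun x => ?_
    by_cases hxG : x ∈ G
    · have : 0 ≤ 8 * (l : ℝ) / a := by positivity
      by_cases hxF : x ∈ F <;> simp [hxF, hxG, this, hS0 x]
    · by_cases hxF : x ∈ F
      · simp only [Set.indicator_of_mem hxF, Set.indicator_of_notMem hxG, Pi.one_apply, mul_one,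
          zero_add]
        rw [le_div_iff₀ ha, mul_comm]
        exact (not_le.1 hxG).le
      · simp [hxF, hxG]
  have h2 : 2 * ∫ x, G.indicator S x ∂μ ≤ ∫ x in F2, visitCount T A (2 * l) x ∂μ := by
    have hc : ∫ x, G.indicator S (T^[l] x) ∂μ = ∫ x, G.indicator S x ∂μ :=
      hT.integral_comp_iterate iG.aestronglyMeasurable l
    have iG' : Integrable (fun x => G.indicator S (T^[l] x)) μ :=
      (hT.iterate l).integrable_comp_of_integrable iG
    rw [two_mul]
    nth_rw 2 [← hc]
    rw [← integral_add iG iG', ← integral_indicator mF2]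
    refine integral_mono (iG.add iG') (iS2.indicator mF2) fun x => ?_
    have hGF : ∀ y, y ∈ G ↔ 8 * (l : ℝ) ≤ a * S y := fun y => Iff.rfl
    have hxF2 : x ∈ F2 ↔ 8 * (l : ℝ) ≤ a * S x + a * S (T^[l] x) := by
      change 4 * ((2 * l : ℕ) : ℝ) ≤ a * visitCount T A (2 * l) x ↔ _
      rw [hadd]; push_cast; constructor <;> intro h <;> linarith
    have p1 := mul_nonneg ha.le (hS0 x)
    have p2 := mul_nonneg ha.le (hS0 (T^[l] x))
    change G.indicator S x + G.indicator S (T^[l] x) ≤ _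
    by_cases hx : x ∈ F2
    · rw [Set.indicator_of_mem hx, hadd]
      exact add_le_add (Set.indicator_le_self' (fun y _ => hS0 y) x)
        (Set.indicator_le_self' (fun y _ => hS0 y) _)
    · rw [hxF2] at hx
      have n1 : x ∉ G := fun h => hx (by rw [hGF] at h; linarith)
      have n2 : T^[l] x ∉ G := fun h => hx (by rw [hGF] at h; linarith)
      rw [Set.indicator_of_notMem n1, Set.indicator_of_notMem n2]
      simpa using Set.indicator_nonneg (fun y _ => visitCount_nonneg (2 * l) y) x
  have e : 16 * (l : ℝ) / a * μ.real F = 2 * (8 * l / a * μ.real F) := by ring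
  linarith

/-- Iterates the doubling inequality J times, starting from l μ(A) = ∫ S_l over F_l, and bounds the
last integrand by its maximum 2^J l. -/
theorem measureReal_le_add_sum_frequentVisits [IsProbabilityMeasure μ]
    (hT : MeasurePreserving T μ μ) (hA : MeasurableSet A) (ha : 0 < a) {l : ℕ} (hl : 0 < l)
    (hla : 4 * (l : ℝ) ≤ a) (J : ℕ) :
    μ.real A ≤ μ.real (frequentVisits T A a (2 ^ J * l))
      + 8 / a * ∑ j ∈ Finset.range J, μ.real (frequentVisits T A a (2 ^ j * l)) := by
  have hl' : (0 : ℝ) < l := by exact_mod_cast hl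
  have key : ∀ J : ℕ, 2 ^ J * (l * μ.real A) ≤
      (∫ x in frequentVisits T A a (2 ^ J * l), visitCount T A (2 ^ J * l) x ∂μ)
        + 2 ^ J * (8 * l / a *
          ∑ j ∈ Finset.range J, μ.real (frequentVisits T A a (2 ^ j * l))) := by
    intro J
    induction J with
    | zero =>
      simp only [pow_zero, one_mul, Finset.range_zero, Finset.sum_empty, mul_zero, add_zero]
      rw [← integral_visitCount hT hA, ← integral_indicator
        (measurableSet_frequentVisits hT.measurable hA a l)]
      refine le_of_eq (integral_congr_ae (.of_forall fun x => ?_))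
      by_cases hx : x ∈ frequentVisits T A a l
      · simp [hx]
      -- Since 4l ≤ a, a single visit suffices for membership in F_l, so the count vanishes off F_l.
      · rw [Set.indicator_of_notMem hx]
        by_contra hne
        unfold visitCount birkhoffSum at hne
        refine hx (hla.trans ?_)
        obtain ⟨k, hk, hk0⟩ := Finset.exists_ne_zero_of_sum_ne_zero hne
        have hkA : T^[k] x ∈ A := Set.mem_of_indicator_ne_zero hk0
        have : (1 : ℝ) ≤ visitCount T A l x := by
          have := Finset.single_le_sum (f := fun k => A.indicator (1 : X → ℝ) (T^[k] x))
            (fun _ _ => Set.indicator_nonneg (fun _ _ => zero_le_one) _) hk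
          rw [Set.indicator_of_mem hkA] at this
          exact this
        nlinarith
    | succ J ih =>
      have h := two_mul_setIntegral_visitCount_le (μ := μ) hT hA ha (2 ^ J * l)
      have e : 2 ^ (J + 1) * l = 2 * (2 ^ J * l) := by ring
      rw [e, Finset.sum_range_succ]
      push_cast at h
      calc (2 : ℝ) ^ (J + 1) * (l * μ.real A) = 2 * (2 ^ J * (l * μ.real A)) := by ring
        _ ≤ 2 * ((∫ x in frequentVisits T A a (2 ^ J * l), visitCount T A (2 ^ J * l) x ∂μ)
            + 2 ^ J * (8 * l / a *
              ∑ j ∈ Finset.range J, μ.real (frequentVisits T A a (2 ^ j * l)))) := by gcongr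
        _ ≤ _ := by
          rw [mul_add]
          refine (add_le_add_left h _).trans (le_of_eq ?_)
          ring
  have hb : ∫ x in frequentVisits T A a (2 ^ J * l), visitCount T A (2 ^ J * l) x ∂μ
      ≤ 2 ^ J * l * μ.real (frequentVisits T A a (2 ^ J * l)) := by
    refine (setIntegral_mono (integrable_visitCount hT.measurable hA _).integrableOn
      (integrable_const ((2 ^ J * l : ℕ) : ℝ)).integrableOn
      fun x => visitCount_le _ x).trans (le_of_eq ?_)
    simp [mul_comm]
  have h := (key J).trans (add_le_add_left hb _)
  have hp : (0 : ℝ) < 2 ^ J * l := by positivity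
  refine le_of_mul_le_mul_left ?_ hp
  calc _ = (2 : ℝ) ^ J * (l * μ.real A) := by ring
    _ ≤ _ := h
    _ = _ := by ring

/-- Start the dyadic estimate at l = ⌊a/4⌋, which is comparable to a. The bound R makes μ(F_{2^j l})
decay geometrically because p > 1, and the leftover term disappears as J → ∞. -/
theorem rpow_mul_measureReal_le [IsProbabilityMeasure μ] (hT : MeasurePreserving T μ μ)
    (hA : MeasurableSet A) (ha : 4 ≤ a) {p R : ℝ} (hp : 1 < p)
    (hR : ∀ l : ℕ, 0 < l → (l : ℝ) ^ (p - 1) * μ.real (frequentVisits T A a l) ≤ R) :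
    a ^ p * μ.real A ≤ 8 ^ p / (1 - (2 ^ (p - 1))⁻¹) * R := by
  have ha0 : 0 < a := by linarith
  set l := ⌊a / 4⌋₊ with hl
  have hl1 : 1 ≤ l := (Nat.one_le_floor_iff _).2 (by linarith)
  have hl0 : (0 : ℝ) < l := by exact_mod_cast hl1
  have hla : 4 * (l : ℝ) ≤ a := by
    have := Nat.floor_le (a := a / 4) (by positivity)
    linarith
  have hal : a ≤ 8 * l := by
    have := Nat.lt_floor_add_one (a / 4)
    have h1 : (1 : ℝ) ≤ l := by exact_mod_cast hl1
    linarith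
  set r : ℝ := (2 ^ (p - 1))⁻¹ with hr
  have hr1 : r < 1 := inv_lt_one_of_one_lt₀ (Real.one_lt_rpow (by norm_num) (by linarith))
  have hr0 : 0 < r := by positivity
  set Q : ℝ := R / (l : ℝ) ^ (p - 1) with hQ
  have hlp : (0 : ℝ) < (l : ℝ) ^ (p - 1) := by positivity
  have hR0 : 0 ≤ R := (mul_nonneg (by positivity) measureReal_nonneg).trans (hR l hl1)
  have hQ0 : 0 ≤ Q := by positivity
  have hF : ∀ j : ℕ, μ.real (frequentVisits T A a (2 ^ j * l)) ≤ Q * r ^ j := by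
    intro j
    have h := hR (2 ^ j * l) (by positivity)
    have e : ((2 ^ j * l : ℕ) : ℝ) ^ (p - 1) = ((2 : ℝ) ^ (p - 1)) ^ j * (l : ℝ) ^ (p - 1) := by
      push_cast
      rw [Real.mul_rpow (by positivity) (by positivity), Real.rpow_pow_comm (by norm_num)]
    rw [e] at h
    rw [hQ, hr, inv_pow, ← div_eq_mul_inv, div_div, le_div_iff₀ (by positivity)]
    linarith
  have hJ : ∀ J : ℕ, μ.real A ≤ Q * r ^ J + 8 / a * (Q * (1 - r)⁻¹) := by
    intro J
    refine (measureReal_le_add_sum_frequentVisits hT hA ha0 hl1 hla J).trans ?_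
    refine add_le_add (hF J) (mul_le_mul_of_nonneg_left ?_ (by positivity))
    refine (Finset.sum_le_sum fun j _ => hF j).trans ?_
    rw [← Finset.mul_sum, ← tsum_geometric_of_lt_one hr0.le hr1]
    exact mul_le_mul_of_nonneg_left ((summable_geometric_of_lt_one hr0.le hr1).sum_le_tsum _
      fun _ _ => by positivity) hQ0
  have hlim : μ.real A ≤ 8 / a * (Q * (1 - r)⁻¹) := by
    have ht : Tendsto (fun J : ℕ => Q * r ^ J + 8 / a * (Q * (1 - r)⁻¹)) atTop
        (𝓝 (Q * 0 + 8 / a * (Q * (1 - r)⁻¹))) :=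
      ((tendsto_pow_atTop_nhds_zero_of_lt_one hr0.le hr1).const_mul Q).add_const _
    simpa using ge_of_tendsto' ht hJ
  have hap : a ^ (p - 1) ≤ 8 ^ (p - 1) * (l : ℝ) ^ (p - 1) := by
    rw [← Real.mul_rpow (by norm_num) hl0.le]
    exact Real.rpow_le_rpow ha0.le hal (by linarith)
  have hsplit : ∀ b : ℝ, 0 < b → b ^ p = b * b ^ (p - 1) := fun b hb => by
    rw [← Real.rpow_one_add' hb.le (by linarith)]; ring_nf
  have h1r : 0 < 1 - r := by linarith
  calc a ^ p * μ.real A = a * a ^ (p - 1) * μ.real A := by rw [hsplit a ha0]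
    _ ≤ a * (8 ^ (p - 1) * (l : ℝ) ^ (p - 1)) * (8 / a * (Q * (1 - r)⁻¹)) := by gcongr
    _ = 8 ^ p / (1 - r) * R := by
      rw [hsplit 8 (by norm_num), hQ]
      field_simp

end FrequentVisits

/-! ### Moving averages as shifted Birkhoff averages -/

section MovingAverage

variable {X : Type*} [MeasurableSpace X] {μ : Measure X}

theorem MeasureTheory.MeasurePreserving.toEquiv_zpow {T : X ≃ᵐ X} (hT : MeasurePreserving T μ μ)
    (i : ℤ) : MeasurePreserving ((T.toEquiv : Equiv.Perm X) ^ i) μ μ := by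
  have hpow : ∀ (S : X ≃ᵐ X), MeasurePreserving S μ μ →
      ∀ n : ℕ, MeasurePreserving ((S.toEquiv : Equiv.Perm X) ^ n) μ μ := by
    intro S hS n
    rw [Equiv.Perm.coe_pow]
    exact hS.iterate n
  obtain ⟨n, rfl | rfl⟩ := i.eq_nat_or_neg
  · rw [zpow_natCast]
    exact hpow T hT n
  · rw [zpow_neg, zpow_natCast, ← inv_pow]
    exact hpow T.symm hT.symm n

theorem movingAverage_eq_birkhoffAverage (T : X ≃ᵐ X) (f : X → ℝ) (v : ℤ) (L : ℕ) (x : X) :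
    movingAverage T f v L x =
      birkhoffAverage ℝ T f L (((T.toEquiv : Equiv.Perm X) ^ (v + 1)) x) := by
  unfold movingAverage birkhoffAverage birkhoffSum
  rw [one_div, smul_eq_mul]
  congr 1
  refine Finset.sum_nbij' (fun i => (i - (v + 1)).toNat) (fun k => v + 1 + k) ?_ ?_ ?_ ?_ ?_
  · intro i hi
    rw [Finset.mem_Icc] at hi
    rw [Finset.mem_range]
    omega
  · intro k hk
    rw [Finset.mem_range] at hk
    rw [Finset.mem_Icc]
    omega
  · intro i hi
    rw [Finset.mem_Icc] at hi
    have : 0 ≤ i - (v + 1) := by omega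
    simp [Int.toNat_of_nonneg this]
  · intro k _
    simp
  · intro i hi
    rw [Finset.mem_Icc] at hi
    have h0 : 0 ≤ i - (v + 1) := by omega
    have h1 : i = ((i - (v + 1)).toNat : ℤ) + (v + 1) := by
      rw [Int.toNat_of_nonneg h0]; ring
    conv_lhs => rw [h1, zpow_add, zpow_natCast, Equiv.Perm.mul_apply, Equiv.Perm.coe_pow]
    rfl

end MovingAverage

/-! ### Integrability, mean zero and large averages of f -/

namespace IsBadFunctionWith

variable {X : Type*} [MeasurableSpace X] {μ : Measure X} {a : ℕ → ℝ} {A : ℕ → Set X} {B : Set X}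
  {f : X → ℝ}

theorem tendsto_atTop (h : IsBadFunctionWith μ a A B f) : Tendsto a atTop atTop := by
  simpa using h.growth 0

theorem measurable (h : IsBadFunctionWith μ a A B f) : Measurable f := by
  intro s _
  have e : f ⁻¹' s = (⋃ n, {x | x ∈ A n ∧ a n ∈ s}) ∪ {x | x ∈ B ∧ (-1 : ℝ) ∈ s}
      ∪ {x | x ∈ (B ∪ ⋃ n, A n)ᶜ ∧ (0 : ℝ) ∈ s} := by
    ext x
    simp only [Set.mem_preimage, Set.mem_union, Set.mem_iUnion, Set.mem_ofPred_eq,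
      Set.mem_compl_iff]
    have hBA : x ∈ B → ∀ n, x ∉ A n := fun hB n hn =>
      Set.disjoint_left.1 h.disjoint_B hB (Set.mem_iUnion.2 ⟨n, hn⟩)
    by_cases hB : x ∈ B
    · rw [h.apply_B x hB]
      simp [hB, hBA hB]
    · by_cases hA : ∃ n, x ∈ A n
      · obtain ⟨n, hn⟩ := hA
        rw [h.apply_A n x hn]
        have : ∀ m, x ∈ A m → m = n := fun m hm => by
          by_contra hne
          exact Set.disjoint_left.1 (h.disjoint_A hne) hm hn
        constructor
        · exact fun hs => Or.inl (Or.inl ⟨n, hn, hs⟩)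
        · rintro ((⟨m, hm, hs⟩ | ⟨hB', -⟩) | ⟨hno, -⟩)
          · rwa [this m hm] at hs
          · exact absurd hB' hB
          · exact absurd (Or.inr ⟨n, hn⟩) hno
      · push Not at hA
        rw [h.apply_else x hB hA]
        simp [hB, hA]
  have hand : ∀ {t : Set X} (q : Prop), MeasurableSet t → MeasurableSet {x | x ∈ t ∧ q} :=
    fun q ht => ht.inter (MeasurableSet.const q)
  rw [e]
  exact ((MeasurableSet.iUnion fun n => hand _ (h.measurableSet_A n)).union
    (hand _ h.measurableSet_B)).union
    (hand _ (h.measurableSet_B.union (MeasurableSet.iUnion h.measurableSet_A)).compl)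

theorem ofReal_eq_tsum (h : IsBadFunctionWith μ a A B f) (x : X) :
    ENNReal.ofReal (f x) = ∑' n, (A n).indicator (fun _ => ENNReal.ofReal (a n)) x := by
  by_cases hA : ∃ n, x ∈ A n
  · obtain ⟨n, hn⟩ := hA
    rw [tsum_eq_single n, Set.indicator_of_mem hn, h.apply_A n x hn]
    exact fun m hm => Set.indicator_of_notMem
      (fun hxm => Set.disjoint_left.1 (h.disjoint_A hm) hxm hn) _
  · push Not at hA
    simp only [Set.indicator_of_notMem (hA _), tsum_zero]
    by_cases hB : x ∈ B
    · simp [h.apply_B x hB]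
    · simp [h.apply_else x hB hA]

theorem ofReal_neg_eq (h : IsBadFunctionWith μ a A B f) (x : X) :
    ENNReal.ofReal (-f x) = B.indicator 1 x := by
  by_cases hB : x ∈ B
  · simp [h.apply_B x hB, hB]
  · rw [Set.indicator_of_notMem hB]
    by_cases hA : ∃ n, x ∈ A n
    · obtain ⟨n, hn⟩ := hA
      have := h.two_lt n
      rw [h.apply_A n x hn, ENNReal.ofReal_eq_zero]
      linarith
    · push Not at hA
      simp [h.apply_else x hB hA]

theorem lintegral_ofReal (h : IsBadFunctionWith μ a A B f) :
    ∫⁻ x, ENNReal.ofReal (f x) ∂μ = μ B := by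
  simp_rw [h.ofReal_eq_tsum]
  rw [lintegral_tsum fun n => (measurable_const.indicator (h.measurableSet_A n)).aemeasurable,
    h.measure_B]
  simp_rw [lintegral_indicator_const (h.measurableSet_A _)]

theorem lintegral_ofReal_neg (h : IsBadFunctionWith μ a A B f) :
    ∫⁻ x, ENNReal.ofReal (-f x) ∂μ = μ B := by
  simp_rw [h.ofReal_neg_eq]
  exact lintegral_indicator_one h.measurableSet_B

theorem integrable [IsFiniteMeasure μ] (h : IsBadFunctionWith μ a A B f) : Integrable f μ := by
  refine ⟨h.measurable.aestronglyMeasurable, ?_⟩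
  have e : ∀ x, ‖f x‖ₑ = ENNReal.ofReal (f x) + ENNReal.ofReal (-f x) := fun x => by
    rcases le_total 0 (f x) with hx | hx
    · rw [Real.enorm_of_nonneg hx, ENNReal.ofReal_of_nonpos (neg_nonpos.2 hx), add_zero]
    · rw [← enorm_neg, Real.enorm_of_nonneg (neg_nonneg.2 hx), ENNReal.ofReal_of_nonpos hx,
        zero_add]
  unfold HasFiniteIntegral
  simp_rw [e]
  rw [lintegral_add_left h.measurable.ennreal_ofReal, h.lintegral_ofReal, h.lintegral_ofReal_neg]
  exact ENNReal.add_lt_top.2 ⟨measure_lt_top _ _, measure_lt_top _ _⟩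

theorem integral_eq_zero [IsFiniteMeasure μ] (h : IsBadFunctionWith μ a A B f) :
    ∫ x, f x ∂μ = 0 := by
  rw [integral_eq_lintegral_pos_part_sub_lintegral_neg_part h.integrable, h.lintegral_ofReal,
    h.lintegral_ofReal_neg, sub_self]

theorem mul_indicator_sub_one_le (h : IsBadFunctionWith μ a A B f) (m : ℕ) (x : X) :
    a m * (A m).indicator 1 x - 1 ≤ f x := by
  by_cases hm : x ∈ A m
  · simp [hm, h.apply_A m x hm]
  · rw [Set.indicator_of_notMem hm, mul_zero, zero_sub]
    by_cases hB : x ∈ B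
    · rw [h.apply_B x hB]
    · by_cases hA : ∃ n, x ∈ A n
      · obtain ⟨n, hn⟩ := hA
        have := h.two_lt n
        rw [h.apply_A n x hn]
        linarith
      · push Not at hA
        rw [h.apply_else x hB hA]
        norm_num

/-- The visits contribute at least 4l and the remaining terms cost at most L ≤ 2l, leaving a sum of
at least 2l ≥ L. The factor 4 in `frequentVisits` is what allows the whole range [l, 2l]. -/
theorem one_le_birkhoffAverage (h : IsBadFunctionWith μ a A B f) {T : X → X} {m l L : ℕ}
    (hl : 0 < l) (hlL : l ≤ L) (hL : L ≤ 2 * l) {x : X}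
    (hx : x ∈ frequentVisits T (A m) (a m) l) : 1 ≤ birkhoffAverage ℝ T f L x := by
  have ha : 0 < a m := by linarith [h.two_lt m]
  have hL0 : (0 : ℝ) < L := by exact_mod_cast hl.trans_le hlL
  have hL' : (L : ℝ) ≤ 2 * l := by exact_mod_cast hL
  have h1 : a m * visitCount T (A m) L x - L ≤ birkhoffSum T f L x := by
    unfold visitCount birkhoffSum
    have := Finset.sum_le_sum fun k (_ : k ∈ Finset.range L) =>
      h.mul_indicator_sub_one_le m (T^[k] x)
    rw [Finset.sum_sub_distrib, ← Finset.mul_sum] at this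
    simpa using this
  have h2 : visitCount T (A m) l x ≤ visitCount T (A m) L x := by
    unfold visitCount birkhoffSum
    exact Finset.sum_le_sum_of_subset_of_nonneg (Finset.range_mono hlL)
      fun _ _ _ => Set.indicator_nonneg (fun _ _ => zero_le_one) _
  have h3 : 4 * (l : ℝ) ≤ a m * visitCount T (A m) l x := hx
  have h4 := mul_le_mul_of_nonneg_left h2 ha.le
  unfold birkhoffAverage
  rw [smul_eq_mul, le_inv_mul_iff₀ hL0]
  linarith

/-- A bound uniform in m and l would bound a_m^p μ(A_m) for all large m. -/
theorem exists_lt_rpow_mul_measureReal [IsProbabilityMeasure μ]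
    (h : IsBadFunctionWith μ a A B f) {p : ℝ} (hp : 1 < p)
    (hap : Tendsto (fun n => a n ^ p * μ.real (A n)) atTop atTop) {T : X → X}
    (hT : MeasurePreserving T μ μ) (R : ℝ) :
    ∃ m l : ℕ, 0 < l ∧ R < (l : ℝ) ^ (p - 1) * μ.real (frequentVisits T (A m) (a m) l) := by
  by_contra! hcon
  obtain ⟨m, h4, hm⟩ := ((h.tendsto_atTop.eventually_ge_atTop 4).and
    (hap.eventually_gt_atTop (8 ^ p / (1 - (2 ^ (p - 1))⁻¹) * R))).exists
  exact hm.not_ge (rpow_mul_measureReal_le hT (h.measurableSet_A m) h4 hp (hcon m))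

end IsBadFunctionWith

/-- Dependent choice for building a sequence block by block: `P` concerns the initial segment of
length n, and `Q k` the k-th block. -/
theorem exists_seq_of_forall_extend {β : Type*} {P : ℕ → (ℕ → β) → Prop}
    {Q : ℕ → ℕ → ℕ → (ℕ → β) → Prop}
    (hP : ∀ n s s', (∀ i < n, s i = s' i) → P n s → P n s')
    (hQ : ∀ k n n' s s', (∀ i < n', s i = s' i) → Q k n n' s → Q k n n' s')
    (s₀ : ℕ → β) (h₀ : P 0 s₀)
    (hext : ∀ k n s, P n s → ∃ n' s', n < n' ∧ (∀ i < n, s' i = s i) ∧ P n' s' ∧ Q k n n' s') :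
    ∃ (s : ℕ → β) (N : ℕ → ℕ), StrictMono N ∧ ∀ k, P (N k) s ∧ Q k (N k) (N (k + 1)) s := by
  choose! fn fs hlt hagree hP' hQ' using hext
  let st : ℕ → {q : ℕ × (ℕ → β) // P q.1 q.2} := fun k => Nat.rec ⟨(0, s₀), h₀⟩
    (fun k q => ⟨(fn k q.1.1 q.1.2, fs k q.1.1 q.1.2), hP' k _ _ q.2⟩) k
  have hN : StrictMono fun k => (st k).1.1 := strictMono_nat_of_lt_succ fun k => hlt k _ _ (st k).2
  have hs : ∀ k j, k ≤ j → ∀ i < (st k).1.1, (st j).1.2 i = (st k).1.2 i := by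
    intro k j hkj
    induction j, hkj using Nat.le_induction with
    | base => exact fun _ _ => rfl
    | succ j hj ih =>
      intro i hi
      rw [← ih i hi]
      exact hagree j _ _ (st j).2 i (hi.trans_le (hN.monotone hj))
  -- Entry i is final by stage i + 1, since the segment lengths are strictly increasing; the limit
  -- sequence is read off there.
  have hlim : ∀ k, ∀ i < (st k).1.1, (st k).1.2 i = (st (i + 1)).1.2 i := by
    intro k i hi
    have hi' : i < (st (i + 1)).1.1 := hN.le_apply (x := i + 1)
    rcases le_total k (i + 1) with h | h
    · exact (hs k _ h i hi).symm
    · exact hs _ k h i hi'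
  exact ⟨fun i => (st (i + 1)).1.2 i, fun k => (st k).1.1, hN, fun k =>
    ⟨hP _ _ _ (hlim k) (st k).2, hQ _ _ _ _ _ (hlim (k + 1)) (hQ' k _ _ (st k).2)⟩⟩

/-! ### Construction of the blocks -/

section Blocks

variable {X : Type*} [MeasurableSpace X] {μ : Measure X} [IsProbabilityMeasure μ]
  {a : ℕ → ℝ} {A : ℕ → Set X} {B : Set X} {f : X → ℝ} {p : ℝ}

/-- The times `w` cover all but ε by preimages of one F_l. The freedom in L permits distinct lengths
within a block, and `R` leaves room for the indices and lengths already used. -/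
theorem IsBadFunctionWith.exists_block (h : IsBadFunctionWith μ a A B f) (hp : 1 < p)
    (hap : Tendsto (fun n => a n ^ p * μ.real (A n)) atTop atTop) {T : X → X}
    (hT : Ergodic T μ) (R : ℝ) {ε : ℝ} (hε : 0 < ε) :
    ∃ (l N : ℕ) (w : ℕ → ℕ), 0 < l ∧ 0 < N ∧ R + N ≤ (l : ℝ) ^ (p - 1) ∧
      μ.real {x | ∀ j < N, ∃ L, l ≤ L ∧ L ≤ 2 * l ∧
        birkhoffAverage ℝ T f L (T^[w j] x) < 1} ≤ ε := by
  -- With Nφ ≥ C, (1 - φ/2)^N ≤ exp(-Nφ/2) ≤ ε. As N ≤ C/φ + 2 and φ ≤ 1, the threshold |R| + C + 2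
  -- below yields R + N ≤ l^(p-1).
  set C : ℝ := 2 * |Real.log ε| with hC
  have hC0 : 0 ≤ C := by positivity
  obtain ⟨m, l, hl, hR⟩ := h.exists_lt_rpow_mul_measureReal hp hap hT.toMeasurePreserving
    (|R| + C + 2)
  set F := frequentVisits T (A m) (a m) l with hF
  set φ := μ.real F with hφ
  have hφ1 : φ ≤ 1 := measureReal_le_one
  have hφ0 : 0 < φ := by
    refine lt_of_le_of_ne measureReal_nonneg fun h0 => ?_
    rw [← h0, mul_zero] at hR
    linarith [abs_nonneg R]
  set N := ⌈C / φ⌉₊ + 1 with hN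
  have hN1 : C / φ ≤ N := by
    rw [hN]; push_cast; linarith [Nat.le_ceil (C / φ)]
  have hN2 : (N : ℝ) ≤ C / φ + 2 := by
    rw [hN]; push_cast; linarith [Nat.ceil_lt_add_one (a := C / φ) (by positivity)]
  obtain ⟨w, hw⟩ := hT.exists_measureReal_forall_iterate_notMem_le
    (measurableSet_frequentVisits hT.measurable (h.measurableSet_A m) (a m) l) N
  refine ⟨l, N, w, hl, Nat.succ_pos _, ?_, ?_⟩
  · have h1 : (|R| + C + 2) / φ ≤ (l : ℝ) ^ (p - 1) := (div_le_iff₀ hφ0).2 hR.le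
    have h2 : |R| + 2 ≤ (|R| + 2) / φ := le_div_self (by positivity) hφ0 hφ1
    have h3 : (|R| + C + 2) / φ = (|R| + 2) / φ + C / φ := by ring
    linarith [le_abs_self R]
  · refine (measureReal_mono ?_).trans (hw.trans ?_)
    · intro x hx j hj hxF
      obtain ⟨L, hlL, hL, hlt⟩ := hx j hj
      exact hlt.not_ge (h.one_le_birkhoffAverage hl hlL hL hxF)
    · have hexp : 1 - φ / 2 ≤ Real.exp (-(φ / 2)) := by
        linarith [Real.add_one_le_exp (-(φ / 2))]
      refine (pow_le_pow_left₀ (by linarith) hexp N).trans ?_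
      rw [← Real.exp_nat_mul, ← Real.exp_log hε, Real.exp_le_exp]
      rw [div_le_iff₀ hφ0] at hN1
      linarith [neg_abs_le (Real.log ε)]

theorem IsBadFunctionWith.exists_movingAverage_sequence (h : IsBadFunctionWith μ a A B f)
    (hp : 1 < p) (hap : Tendsto (fun n => a n ^ p * μ.real (A n)) atTop atTop) {T : X ≃ᵐ X}
    (hT : Ergodic T μ) :
    ∃ (s : ℕ → ℤ × ℕ) (N : ℕ → ℕ), StrictMono N ∧ ∀ k,
      (∀ i < N k, 0 < (s i).2 ∧ (i : ℝ) + 1 ≤ ((s i).2 : ℝ) ^ (p - 1) ∧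
        ∀ j < i, (s j).2 ≤ (s i).2 ∧ (p ≤ 2 → (s j).2 < (s i).2)) ∧
      μ.real {x | ∀ i, N k ≤ i → i < N (k + 1) → movingAverage T f (s i).1 (s i).2 x < 1}
        ≤ (1 / 2) ^ k := by
  refine exists_seq_of_forall_extend
    (P := fun n (s : ℕ → ℤ × ℕ) => ∀ i < n, 0 < (s i).2 ∧ (i : ℝ) + 1 ≤ ((s i).2 : ℝ) ^ (p - 1) ∧
        ∀ j < i, (s j).2 ≤ (s i).2 ∧ (p ≤ 2 → (s j).2 < (s i).2))
    (Q := fun k n n' (s : ℕ → ℤ × ℕ) => μ.real {x | ∀ i, n ≤ i → i < n' →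
      movingAverage T f (s i).1 (s i).2 x < 1} ≤ (1 / 2) ^ k) ?_ ?_ 0 (by simp) ?_
  · intro n s s' hss hs i hi
    rw [← hss i hi]
    obtain ⟨h1, h2, h3⟩ := hs i hi
    refine ⟨h1, h2, fun j hj => ?_⟩
    rw [← hss j (hj.trans hi)]
    exact h3 j hj
  · intro k n n' s s' hss hs
    refine le_trans (le_of_eq ?_) hs
    congr 1
    ext x
    refine forall₃_congr fun i _ hi => ?_
    rw [hss i hi]
  · intro k n s hs
    set M : ℕ := ∑ i ∈ Finset.range n, (s i).2 with hM
    have hsM : ∀ i < n, (s i).2 ≤ M := fun i hi =>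
      Finset.single_le_sum (f := fun i => (s i).2) (fun _ _ => Nat.zero_le _)
        (Finset.mem_range.2 hi)
    -- The summand n gives the growth condition up to index n + K; the summand (M + 1)^(p-1) makes l
    -- exceed all earlier lengths.
    obtain ⟨l, K, w, hl, hK, hlK, hw⟩ := h.exists_block hp hap hT
      (n + ((M : ℝ) + 1) ^ (p - 1)) (ε := (1 / 2) ^ k) (by positivity)
    have hp0 : 0 < p - 1 := by linarith
    have hMp : 0 ≤ ((M : ℝ) + 1) ^ (p - 1) := by positivity
    have hMl : M < l := by
      have : ((M : ℝ) + 1) ^ (p - 1) ≤ (l : ℝ) ^ (p - 1) := by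
        have : (0 : ℝ) ≤ n + K := by positivity
        linarith
      rw [Real.rpow_le_rpow_iff (by positivity) (by positivity) hp0] at this
      exact_mod_cast this
    have hnK : (n : ℝ) + K ≤ (l : ℝ) ^ (p - 1) := by linarith
    have hKl : p ≤ 2 → K ≤ l := fun hp2 => by
      have h1 : (l : ℝ) ^ (p - 1) ≤ (l : ℝ) ^ (1 : ℝ) :=
        Real.rpow_le_rpow_of_exponent_le (by exact_mod_cast hl) (by linarith)
      rw [Real.rpow_one] at h1
      have : (K : ℝ) ≤ l := by
        have : (0 : ℝ) ≤ n := by positivity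
        linarith
      exact_mod_cast this
    -- For p ≤ 2 the block has K ≤ l^(p-1) ≤ l terms, so strictly increasing lengths fit in [l, 2l].
    -- For p > 2 it may be longer than l, and the length is kept constant.
    let len : ℕ → ℕ := fun i => if p ≤ 2 then l + (i - n) else l
    have hlen1 : ∀ i, l ≤ len i := fun i => by
      simp only [len]; split_ifs <;> omega
    have hlen2 : ∀ i, n ≤ i → i < n + K → len i ≤ 2 * l := fun i h1 h2 => by
      simp only [len]
      split_ifs with hp2
      · have := hKl hp2
        omega
      · omega
    -- The shift by -1 compensates for moving averages starting at v + 1.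
    let s' : ℕ → ℤ × ℕ := fun i => if i < n then s i else ((w (i - n) : ℤ) - 1, len i)
    have hs'1 : ∀ i < n, s' i = s i := fun i hi => if_pos hi
    have hs'2 : ∀ i, n ≤ i → s' i = ((w (i - n) : ℤ) - 1, len i) := fun i hi =>
      if_neg hi.not_gt
    refine ⟨n + K, s', by omega, hs'1, ?_, ?_⟩
    · intro i hi
      rcases lt_or_ge i n with hin | hin
      · rw [hs'1 i hin]
        obtain ⟨h1, h2, h3⟩ := hs i hin
        refine ⟨h1, h2, fun j hj => ?_⟩
        rw [hs'1 j (hj.trans hin)]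
        exact h3 j hj
      · rw [hs'2 i hin]
        refine ⟨hl.trans_le (hlen1 i), ?_, fun j hj => ?_⟩
        · have h1 : (i : ℝ) + 1 ≤ n + K := by exact_mod_cast hi
          refine h1.trans (hnK.trans (Real.rpow_le_rpow (by positivity) ?_ hp0.le))
          exact_mod_cast hlen1 i
        · rcases lt_or_ge j n with hjn | hjn
          · rw [hs'1 j hjn]
            have h1 : (s j).2 < len i := ((hsM j hjn).trans_lt hMl).trans_le (hlen1 i)
            exact ⟨h1.le, fun _ => h1⟩
          · rw [hs'2 j hjn]
            simp only [len]
            constructor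
            · split_ifs <;> omega
            · intro hp2
              simp only [hp2, if_true]
              omega
    · refine (measureReal_mono ?_).trans hw
      intro x hx j hj
      refine ⟨len (n + j), hlen1 _, hlen2 _ (by omega) (by omega), ?_⟩
      have h1 := hx (n + j) (by omega) (by omega)
      rw [hs'2 _ (by omega), movingAverage_eq_birkhoffAverage] at h1
      simp only [sub_add_cancel, zpow_natCast, Equiv.Perm.coe_pow, Nat.add_sub_cancel_left] at h1
      exact h1

end Blocks

/-! ### Conclusion: Borel–Cantelli and non-convergence -/

theorem mainTheorem1 {X : Type*} [MeasurableSpace X] (μ : Measure X) [IsProbabilityMeasure μ]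
    (p : ℝ) (hp : 1 < p) (f : X → ℝ) (hf : f ∈ badFamily μ p)
    (T : X ≃ᵐ X) (hT : Ergodic T μ) :
    ∃ (v : ℕ → ℤ) (L : ℕ → ℕ),
      -- the pair with index `n` is the `(n + 1)`-st term of the sequence
      (∀ n, 0 < L n) ∧ Monotone L ∧ (p ≤ 2 → StrictMono L) ∧
      (∀ n : ℕ, ((n : ℝ) + 1) ^ (1 / (p - 1)) ≤ (L n : ℝ)) ∧
      (∀ᵐ x ∂μ, 0 < limsup (fun n => (movingAverage T f (v n) (L n) x : EReal)) atTop) ∧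
      (∀ᵐ x ∂μ, ¬ ∃ c : ℝ, Tendsto (fun n => movingAverage T f (v n) (L n) x) atTop (𝓝 c)) := by
  obtain ⟨a, A, B, h, hap⟩ := hf
  obtain ⟨s, N, hN, hs⟩ := h.exists_movingAverage_sequence hp hap hT
  have hp0 : 0 < p - 1 := by linarith
  have hPs : ∀ i, 0 < (s i).2 ∧ (i : ℝ) + 1 ≤ ((s i).2 : ℝ) ^ (p - 1) ∧
      ∀ j < i, (s j).2 ≤ (s i).2 ∧ (p ≤ 2 → (s j).2 < (s i).2) := fun i =>
    (hs (i + 1)).1 i (hN.le_apply (x := i + 1))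
  have hL : ∀ n : ℕ, ((n : ℝ) + 1) ^ (1 / (p - 1)) ≤ ((s n).2 : ℝ) := fun n => by
    rw [one_div]
    exact (Real.rpow_inv_le_iff_of_pos (by positivity) (by positivity) hp0).2 (hPs n).2.1
  have hfreq : ∀ᵐ x ∂μ, ∃ᶠ n in atTop, 1 ≤ movingAverage T f (s n).1 (s n).2 x := by
    have hsum : ∑' k, μ {x | ∀ i, N k ≤ i → i < N (k + 1) →
        movingAverage T f (s i).1 (s i).2 x < 1} ≠ ⊤ := by
      refine ne_top_of_le_ne_top summable_geometric_two.tsum_ofReal_ne_top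
        (ENNReal.tsum_le_tsum fun k => ?_)
      rw [ENNReal.le_ofReal_iff_toReal_le (measure_ne_top _ _) (by positivity)]
      exact (hs k).2
    -- Borel–Cantelli: almost every x has, in all but finitely many blocks, an average at least 1.
    filter_upwards [ae_eventually_notMem hsum] with x hx
    rw [frequently_atTop]
    intro b
    obtain ⟨k, hk, hkb⟩ := (hx.and (eventually_ge_atTop b)).exists
    push Not at hk
    obtain ⟨i, hi, -, h1⟩ := hk
    exact ⟨i, hkb.trans (hN.le_apply.trans hi), h1⟩
  have hLtop : Tendsto (fun n => (s n).2) atTop atTop := by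
    rw [← tendsto_natCast_atTop_iff (R := ℝ)]
    refine tendsto_atTop_mono hL ?_
    exact (tendsto_rpow_atTop (one_div_pos.2 hp0)).comp
      (tendsto_atTop_add_const_right _ _ tendsto_natCast_atTop_atTop)
  refine ⟨fun n => (s n).1, fun n => (s n).2, fun n => (hPs n).1, ?_, ?_, hL, ?_, ?_⟩
  · refine monotone_nat_of_le_succ fun n => ((hPs (n + 1)).2.2 n n.lt_succ_self).1
  · exact fun hp2 => strictMono_nat_of_lt_succ fun n =>
      ((hPs (n + 1)).2.2 n n.lt_succ_self).2 hp2
  · filter_upwards [hfreq] with x hx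
    refine zero_lt_one.trans_le (le_limsup_of_frequently_le (hx.mono fun n hn => ?_))
    exact_mod_cast hn
  -- Convergence to 0 in measure, with an a.e. convergent subsequence, forces any limit to be 0,
  -- contradicting averages at least 1 infinitely often.
  · have hmeas : TendstoInMeasure μ (fun n => movingAverage T f (s n).1 (s n).2) atTop
        (fun _ => (0 : ℝ)) := by
      have hav : ∀ n, movingAverage T f (s n).1 (s n).2 = birkhoffAverage ℝ T f (s n).2 ∘
          ((T.toEquiv : Equiv.Perm X) ^ ((s n).1 + 1)) := fun n =>
        funext (movingAverage_eq_birkhoffAverage T f _ _)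
      have hmp : ∀ n, MeasurePreserving ((T.toEquiv : Equiv.Perm X) ^ ((s n).1 + 1)) μ μ :=
        fun n => hT.toMeasurePreserving.toEquiv_zpow _
      have hm : ∀ n, AEStronglyMeasurable (birkhoffAverage ℝ T f (s n).2) μ := fun n =>
        (hT.toMeasurePreserving.integrable_birkhoffAverage h.integrable _).aestronglyMeasurable
      refine tendstoInMeasure_of_tendsto_eLpNorm one_ne_zero (fun n => ?_)
        aestronglyMeasurable_const ?_
      · rw [hav]
        exact (hm n).comp_measurePreserving (hmp n)
      · have := (hT.tendsto_birkhoffAverage_L1 h.integrable).comp hLtop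
        rw [h.integral_eq_zero] at this
        refine this.congr fun n => ?_
        rw [hav]
        exact (eLpNorm_comp_measurePreserving ((hm n).sub aestronglyMeasurable_const)
          (hmp n)).symm
    obtain ⟨ns, hns, hae⟩ := hmeas.exists_seq_tendsto_ae
    filter_upwards [hfreq, hae] with x hx hx0
    rintro ⟨c, hc⟩
    have hc0 : c = 0 := tendsto_nhds_unique (hc.comp hns.tendsto_atTop) hx0
    rw [hc0] at hc
    obtain ⟨n, hn1, hn2⟩ := (hx.and_eventually (hc.eventually (gt_mem_nhds one_pos))).exists
    linarith
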